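/- All graphs are finite and simple. For a graph $G$ let $d_G(v)$ denote the degree of the vertex $v$, and let the Laplacian matching polynomial of $G$ be $$\mathscr{LM}_G(x)=\sum_{M}(-1)^{|M|}\prod_{v\in V(G)\setminus V(M)}\bigl(x-d_G(v)\bigr),$$ where $M$ runs over all matchings of $G$ (including the empty one) and $V(M)$ is the set of vertices covered by $M$. Let $G$ be a connected graph on $n$ vertices, let $e$ be a non-edge of $G$ (a pair of distinct non-adjacent vertices), and let $G+e$ be the graph obtained from $G$ by adding $e$. Then adding $e$ cannot cause a two-place Laplacian matching root integral variation; that is, it is impossible that exactly two Laplacian matching roots of $G$ increase by $1$ and all the others remain unchanged. Precisely: there are no listings $r_1,\dots,r_n$ and $s_1,\dots,s_n$ (in any order, with multiplicity) of the roots of $\mathscr{LM}_G$ and of $\mathscr{LM}_{G+e}$, respectively, and no indices $i\neq j$, such that $s_i=r_i+1$, $s_j=r_j+1$, and $s_k=r_k$ for all $k\notin\{i,j\}$. In particular, this holds when both families of roots are listed in non-increasing order. -/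

import Mathlib

open Polynomial

/-- The set of matchings of a finite graph: sets of pairwise vertex-disjoint edges
(the empty set included). -/
noncomputable def SimpleGraph.matchingFinset {V : Type*} [Fintype V] (G : SimpleGraph V) :
    Finset (Finset (Sym2 V)) :=
  open Classical in
  G.edgeFinset.powerset.filter fun M =>
    ∀ e ∈ M, ∀ f ∈ M, e ≠ f → ∀ v : V, v ∈ e → v ∉ f

/-- The Laplacian matching polynomial
`∑_M (-1)^|M| ∏_{v not covered by M} (x - d(v))`, summed over the matchings `M` of `G`. -/
noncomputable def SimpleGraph.laplacianMatchingPoly {V : Type*} [Fintype V]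
    (G : SimpleGraph V) : ℤ[X] :=
  open Classical in
  ∑ M ∈ G.matchingFinset,
    (-1) ^ M.card *
      ∏ v ∈ Finset.univ.filter (fun v : V => ∀ e ∈ M, v ∉ e), (X - C (G.degree v : ℤ))

/-- The roots of the Laplacian matching polynomial, listed with multiplicity. They are taken in
`ℂ`, so that there are exactly as many as vertices. (They are all real and nonnegative, but
nothing below relies on this.) -/
noncomputable def SimpleGraph.laplacianMatchingRoots {V : Type*} [Fintype V]
    (G : SimpleGraph V) : Multiset ℂ :=
  G.laplacianMatchingPoly.aroots ℂ

/-- Two-place Laplacian matching root integral variation from `G` to `H`: the roots of `G` and of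
`H` can be listed, with multiplicity, as `r 0, r 1, …` and `s 0, s 1, …` so that exactly two
entries increase by `1` while all the others stay the same. The listings are arbitrary, so this
covers in particular the case where both are in non-increasing order. -/
def SimpleGraph.TwoPlaceLMRIV {V : Type*} [Fintype V] (G H : SimpleGraph V) : Prop :=
  ∃ r s : Fin (Fintype.card V) → ℂ,
    Finset.univ.val.map r = G.laplacianMatchingRoots ∧
    Finset.univ.val.map s = H.laplacianMatchingRoots ∧
    ∃ i j : Fin (Fintype.card V), i ≠ j ∧
      s i = r i + 1 ∧ s j = r j + 1 ∧ ∀ k, k ≠ i → k ≠ j → s k = r k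

/-! Write `P` for the Laplacian matching polynomial of `G`, and `P_u` for the signed matching sum
with `u` deleted and the other weights `x - d_G` kept. Adding `uv` turns `P` into `P - P_u - P_v`
(`weightedMatchingSum_sup_edge`). If only two roots change, then `P` divides `q * (P_u + P_v)`,
where `q` is the monic quadratic vanishing at the two old roots.

Let `L f` be the coefficient of `x^(n-1)` in `f mod P`, that is, the coefficient of `1/x` in `f / P`
at infinity. By Godsil's path tree, `P_u / P` is the `(u, u)` entry of the resolvent of a real
symmetric matrix `T`, so `L (f * P_u)` is that entry of `f(T)`. Hence, with `q̄` the conjugate of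
`q`, `L (q̄ * q * P_u)` is the squared norm of column `u` of `q(T)`. As `q` is monic, each path of
length two from `u` contributes exactly `1`. Connectedness and `u ≁ v` provide such a path, whereas
divisibility forces the sum of these values for `u` and `v` to vanish.

The path tree is never built: two levels of the vertex expansion suffice
(`map_quadratic_mul_quadratic_mul`). -/

namespace SimpleGraph

/-! ### Weighted matching sums -/

variable {V : Type*} [Fintype V] {R : Type*} [CommRing R]

open Classical in
/-- The matchings of `G` all of whose edges lie inside `W`. -/
noncomputable def matchingsIn (G : SimpleGraph V) (W : Finset V) : Finset (Finset (Sym2 V)) :=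
  G.matchingFinset.filter fun M => ∀ e ∈ M, ∀ v ∈ e, v ∈ W

open Classical in
/-- The signed matching sum of the subgraph of `G` induced on `W`, with vertex weights `y`. -/
noncomputable def weightedMatchingSum (G : SimpleGraph V) (y : V → R) (W : Finset V) : R :=
  ∑ M ∈ G.matchingsIn W, (-1) ^ M.card * ∏ v ∈ W.filter (fun v => ∀ e ∈ M, v ∉ e), y v

theorem mem_matchingsIn {G : SimpleGraph V} {W : Finset V} {M : Finset (Sym2 V)} :
    M ∈ G.matchingsIn W ↔ (∀ e ∈ M, e ∈ G.edgeSet) ∧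
      (∀ e ∈ M, ∀ f ∈ M, e ≠ f → ∀ v : V, v ∈ e → v ∉ f) ∧ ∀ e ∈ M, ∀ v ∈ e, v ∈ W := by
  classical
  simp only [matchingsIn, matchingFinset, Finset.mem_filter, Finset.mem_powerset, and_assoc]
  refine and_congr_left fun _ => ?_
  simp [Finset.subset_iff]

theorem laplacianMatchingPoly_eq_weightedMatchingSum (G : SimpleGraph V) (S : Type*) [CommRing S]
    [Algebra ℤ S] [DecidableRel G.Adj] :
    G.laplacianMatchingPoly.map (algebraMap ℤ S) =
      G.weightedMatchingSum (fun v => X - C (G.degree v : S)) Finset.univ := by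
  classical
  have h : G.matchingsIn Finset.univ = G.matchingFinset := by
    simp [matchingsIn]
  simp only [laplacianMatchingPoly, weightedMatchingSum, h, Polynomial.map_sum, Polynomial.map_mul,
    Polynomial.map_pow, Polynomial.map_neg, Polynomial.map_one, Polynomial.map_prod,
    Polynomial.map_sub, Polynomial.map_X, Polynomial.map_C]
  refine Finset.sum_congr rfl fun M _ => ?_
  congr 1
  refine Finset.prod_congr (by congr) fun v _ => ?_
  simp only [map_natCast]
  congr!

theorem weightedMatchingSum_congr {G H : SimpleGraph V} {y z : V → R} {W : Finset V}
    (hadj : ∀ a ∈ W, ∀ b ∈ W, (G.Adj a b ↔ H.Adj a b)) (hy : ∀ a ∈ W, y a = z a) :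
    G.weightedMatchingSum y W = H.weightedMatchingSum z W := by
  classical
  have h : G.matchingsIn W = H.matchingsIn W := by
    ext M
    simp only [mem_matchingsIn]
    have key : (∀ e ∈ M, ∀ v ∈ e, v ∈ W) →
        ((∀ e ∈ M, e ∈ G.edgeSet) ↔ (∀ e ∈ M, e ∈ H.edgeSet)) := by
      intro hW
      refine forall₂_congr fun e he => ?_
      have := hW e he
      induction e with
      | h a b =>
        simp only [mem_edgeSet]
        exact hadj a (this a (by simp)) b (this b (by simp))
    tauto
  rw [weightedMatchingSum, weightedMatchingSum, h]
  refine Finset.sum_congr rfl fun M _ => ?_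
  congr 1
  exact Finset.prod_congr rfl fun v hv => hy v (Finset.mem_filter.1 hv).1

theorem weightedMatchingSum_empty (G : SimpleGraph V) (y : V → R) :
    G.weightedMatchingSum y ∅ = 1 := by
  have h : G.matchingsIn ∅ = {∅} := by
    ext M
    simp only [mem_matchingsIn, Finset.notMem_empty, Finset.mem_singleton]
    constructor
    · rintro ⟨-, -, h⟩
      refine Finset.eq_empty_of_forall_notMem fun e he => ?_
      induction e with
      | h a b => exact h _ he a (by simp)
    · rintro rfl
      simp
  simp [weightedMatchingSum, h]

open Classical in
/-- Expansion of the weighted matching sum at a vertex. -/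
theorem weightedMatchingSum_eq_erase (G : SimpleGraph V) (y : V → R) {W : Finset V} {u : V}
    (hu : u ∈ W) :
    G.weightedMatchingSum y W = y u * G.weightedMatchingSum y (W.erase u) -
      ∑ w ∈ W.filter (fun w => G.Adj u w), G.weightedMatchingSum y ((W.erase u).erase w) := by
  rw [weightedMatchingSum, ← Finset.sum_filter_add_sum_filter_not _ (fun M => ∀ e ∈ M, u ∉ e),
    sub_eq_add_neg]
  congr 1
  · have h : (G.matchingsIn W).filter (fun M => ∀ e ∈ M, u ∉ e) = G.matchingsIn (W.erase u) := by
      ext M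
      simp only [Finset.mem_filter, mem_matchingsIn, Finset.mem_erase]
      constructor
      · rintro ⟨⟨h1, h2, h3⟩, h4⟩
        exact ⟨h1, h2, fun e he v hv => ⟨fun h => h4 e he (h ▸ hv), h3 e he v hv⟩⟩
      · rintro ⟨h1, h2, h3⟩
        exact ⟨⟨h1, h2, fun e he v hv => (h3 e he v hv).2⟩, fun e he hv => (h3 e he u hv).1 rfl⟩
    rw [h, weightedMatchingSum, Finset.mul_sum]
    refine Finset.sum_congr rfl fun M hM => ?_
    rw [← h, Finset.mem_filter] at hM
    have h' : W.filter (fun v => ∀ e ∈ M, v ∉ e) =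
        insert u ((W.erase u).filter (fun v => ∀ e ∈ M, v ∉ e)) := by
      conv_lhs => rw [← Finset.insert_erase hu, Finset.filter_insert, if_pos hM.2]
    rw [h', Finset.prod_insert (by simp)]
    ring
  · simp only [weightedMatchingSum]
    rw [← Finset.sum_neg_distrib]
    simp_rw [← Finset.sum_neg_distrib]
    rw [Finset.sum_sigma']
    symm
    have key : ∀ p ∈ (W.filter (fun w => G.Adj u w)).sigma
        (fun w => G.matchingsIn ((W.erase u).erase w)), s(u, p.1) ∉ p.2 := by
      rintro ⟨w, M⟩ hp hmem
      simp only [Finset.mem_sigma, mem_matchingsIn] at hp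
      simpa using hp.2.2.2 _ hmem u (by simp)
    -- A matching covering `u` is an edge `uw` plus a matching avoiding `u` and `w`.
    refine Finset.sum_bij (fun p _ => insert s(u, p.1) p.2) ?_ ?_ ?_ ?_
    · rintro ⟨w, M⟩ hp
      simp only [Finset.mem_sigma, mem_matchingsIn, Finset.mem_filter, Finset.mem_erase] at hp
      obtain ⟨⟨hw, huw⟩, h1, h2, h3⟩ := hp
      simp only [Finset.mem_filter, mem_matchingsIn, Finset.mem_insert, forall_eq_or_imp]
      refine ⟨⟨⟨huw, h1⟩, ⟨⟨fun h => absurd rfl h, ?_⟩, ?_⟩, ?_, ?_⟩, ?_⟩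
      · intro f hf _ v hv hvf
        have := h3 f hf v hvf
        simp only [Sym2.mem_iff] at hv
        tauto
      · intro f hf
        refine ⟨fun _ v hvf hv => ?_, h2 f hf⟩
        have := h3 f hf v hvf
        simp only [Sym2.mem_iff] at hv
        tauto
      · intro v hv
        simp only [Sym2.mem_iff] at hv
        rcases hv with rfl | rfl <;> assumption
      · exact fun e he v hv => (h3 e he v hv).2.2
      · simp
    · rintro ⟨w, M⟩ hp ⟨w', M'⟩ hp' heq
      have k := key _ hp
      have k' := key _ hp'
      simp only [Finset.mem_sigma, mem_matchingsIn, Finset.mem_filter, Finset.mem_erase] at hp hp'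
      simp only at heq k k'
      have hmem : s(u, w) ∈ insert s(u, w') M' := heq ▸ Finset.mem_insert_self _ _
      have hww : w = w' := by
        rcases Finset.mem_insert.1 hmem with h | h
        · exact Sym2.congr_right.1 h
        · exact absurd rfl (hp'.2.2.2 _ h u (by simp)).2.1
      subst hww
      have : M = M' := by
        rw [← Finset.erase_insert k, heq, Finset.erase_insert k']
      rw [this]
    · intro M hM
      simp only [Finset.mem_filter, mem_matchingsIn, not_forall, not_not] at hM
      obtain ⟨⟨h1, h2, h3⟩, e, he, hue⟩ := hM
      obtain ⟨w, rfl⟩ := Sym2.mem_iff_exists.1 hue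
      refine ⟨⟨w, M.erase s(u, w)⟩, ?_, Finset.insert_erase he⟩
      simp only [Finset.mem_sigma, mem_matchingsIn, Finset.mem_filter, Finset.mem_erase]
      refine ⟨⟨h3 _ he w (by simp), h1 _ he⟩, fun e h => h1 e h.2,
        fun e h f h' => h2 e h.2 f h'.2, ?_⟩
      intro f hf v hv
      refine ⟨?_, ?_, h3 f hf.2 v hv⟩
      · rintro rfl
        exact h2 _ hf.2 _ he hf.1 v hv (by simp)
      · rintro rfl
        exact h2 _ hf.2 _ he hf.1 v hv (by simp)
    · rintro ⟨w, M⟩ hp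
      have k := key _ hp
      simp only at k
      simp only [Finset.mem_sigma, mem_matchingsIn, Finset.mem_filter, Finset.mem_erase] at hp
      rw [Finset.card_insert_of_notMem k, pow_succ]
      have : W.filter (fun v => ∀ e ∈ insert s(u, w) M, v ∉ e) =
          ((W.erase u).erase w).filter (fun v => ∀ e ∈ M, v ∉ e) := by
        ext v
        simp only [Finset.mem_filter, Finset.mem_insert, forall_eq_or_imp, Sym2.mem_iff,
          Finset.mem_erase]
        tauto
      simp only [this]
      ring

-- In the expansion at `u`, the first term has degree `|W|` and the others `|W| - 2`. Exact degrees
-- are what make `L` computable.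
open Classical in
theorem weightedMatchingSum_monic {S : Type*} [CommRing S] [Nontrivial S] (G : SimpleGraph V)
    (d : V → S) (W : Finset V) :
    (G.weightedMatchingSum (fun v => X - C (d v)) W).Monic ∧
      (G.weightedMatchingSum (fun v => X - C (d v)) W).natDegree = W.card := by
  induction hn : W.card using Nat.strong_induction_on generalizing W with
  | _ n ih =>
    rcases W.eq_empty_or_nonempty with rfl | ⟨u, hu⟩
    · simp only [weightedMatchingSum_empty, monic_one, natDegree_one, true_and]
      simpa using hn
    · have hpos := Finset.card_pos.2 ⟨u, hu⟩
      have hc := Finset.card_erase_of_mem hu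
      obtain ⟨hm, hd⟩ := ih (n - 1) (by omega) (W.erase u) (by omega)
      rw [weightedMatchingSum_eq_erase G _ hu]
      set A := G.weightedMatchingSum (fun v => X - C (d v)) (W.erase u)
      have hmon : ((X - C (d u)) * A).Monic := (monic_X_sub_C _).mul hm
      have hdeg : ((X - C (d u)) * A).natDegree = n := by
        rw [(monic_X_sub_C _).natDegree_mul hm, natDegree_X_sub_C, hd]
        omega
      have hlt : (∑ w ∈ W.filter (fun w => G.Adj u w),
          G.weightedMatchingSum (fun v => X - C (d v)) ((W.erase u).erase w)).degree <
          ((X - C (d u)) * A).degree := by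
        rw [degree_eq_natDegree hmon.ne_zero, hdeg]
        refine lt_of_le_of_lt (degree_sum_le _ _) ?_
        rw [Finset.sup_lt_iff (by exact WithBot.bot_lt_coe _)]
        intro w hw
        rw [Finset.mem_filter] at hw
        have hw' : w ∈ W.erase u := Finset.mem_erase.2 ⟨hw.2.ne', hw.1⟩
        have h1 := Finset.card_erase_of_mem hw'
        have h2 := Finset.card_pos.2 ⟨w, hw'⟩
        obtain ⟨hm', hd'⟩ := ih (n - 2) (by omega) ((W.erase u).erase w) (by omega)
        rw [degree_eq_natDegree hm'.ne_zero, hd']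
        exact_mod_cast (by omega : n - 2 < n)
      refine ⟨hmon.sub_of_left hlt, ?_⟩
      rw [natDegree_eq_of_degree_eq (degree_sub_eq_left_of_degree_lt hlt), hdeg]

open Classical in
/-- Adding the edge `uv` while lowering the weights of `u` and `v` by one. -/
theorem weightedMatchingSum_sup_edge (G : SimpleGraph V) {y z : V → R} {W : Finset V} {u v : V}
    (hu : u ∈ W) (hv : v ∈ W) (huv : u ≠ v) (hadj : ¬ G.Adj u v)
    (hzu : z u = y u - 1) (hzv : z v = y v - 1) (hz : ∀ w, w ≠ u → w ≠ v → z w = y w) :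
    (G ⊔ edge u v).weightedMatchingSum z W = G.weightedMatchingSum y W -
      G.weightedMatchingSum y (W.erase u) - G.weightedMatchingSum y (W.erase v) := by
  obtain ⟨H, hH⟩ : ∃ H, H = G ⊔ edge u v := ⟨_, rfl⟩
  rw [← hH]
  have hG : ∀ U : Finset V, u ∉ U →
      H.weightedMatchingSum z U = G.weightedMatchingSum z U := by
    intro U hU
    refine weightedMatchingSum_congr (fun a ha b hb => ?_) fun _ _ => rfl
    have : a ≠ u := fun h => hU (h ▸ ha)
    have : b ≠ u := fun h => hU (h ▸ hb)
    simp only [hH, sup_adj, edge_adj]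
    tauto
  have hy : ∀ U : Finset V, u ∉ U → v ∉ U →
      G.weightedMatchingSum z U = G.weightedMatchingSum y U := by
    intro U hU hU'
    exact weightedMatchingSum_congr (fun _ _ _ _ => Iff.rfl) fun a ha =>
      hz a (fun h => hU (h ▸ ha)) fun h => hU' (h ▸ ha)
  -- The sum is affine in the weight of `v`, with slope the sum over `U.erase v`.
  have hlow : ∀ U : Finset V, u ∉ U → v ∈ U → G.weightedMatchingSum z U =
      G.weightedMatchingSum y U - G.weightedMatchingSum y (U.erase v) := by
    intro U hU hU'
    rw [weightedMatchingSum_eq_erase G z hU', weightedMatchingSum_eq_erase G y hU', hzv,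
      hy (U.erase v) (by simp [hU]) (by simp)]
    rw [Finset.sum_congr rfl fun w _ => hy ((U.erase v).erase w) (by simp [hU]) (by simp)]
    ring
  have hfil : W.filter (fun w => H.Adj u w) =
      insert v (W.filter (fun w => G.Adj u w)) := by
    ext w
    simp only [Finset.mem_filter, Finset.mem_insert, hH, sup_adj, edge_adj]
    constructor
    · tauto
    · rintro (rfl | h)
      · tauto
      · tauto
  have hfil' : (W.erase v).filter (fun w => G.Adj u w) = W.filter (fun w => G.Adj u w) := by
    ext w
    simp only [Finset.mem_filter, Finset.mem_erase]
    constructor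
    · tauto
    · rintro ⟨h1, h2⟩
      exact ⟨⟨fun h => hadj (h ▸ h2), h1⟩, h2⟩
  have hsum : ∑ w ∈ W.filter (fun w => G.Adj u w),
        H.weightedMatchingSum z ((W.erase u).erase w) =
      ∑ w ∈ W.filter (fun w => G.Adj u w), G.weightedMatchingSum y ((W.erase u).erase w) -
      ∑ w ∈ W.filter (fun w => G.Adj u w),
        G.weightedMatchingSum y (((W.erase v).erase u).erase w) := by
    rw [← Finset.sum_sub_distrib]
    refine Finset.sum_congr rfl fun w hw => ?_
    rw [Finset.mem_filter] at hw
    have : v ≠ w := fun h => hadj (h ▸ hw.2)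
    rw [hG _ (by simp), hlow _ (by simp) (by simp [huv.symm, this, hv]),
      Finset.erase_right_comm (a := w) (b := v), Finset.erase_right_comm (a := u) (b := v)]
  -- The two lowered weights produce `+1` times the sum without `u` and `v`; the matchings through
  -- `uv` cancel it.
  rw [weightedMatchingSum_eq_erase _ z hu, hfil, Finset.sum_insert (by simp [hadj]), hsum,
    hG _ (by simp), hG _ (by simp), hlow _ (by simp) (by simp [huv.symm, hv]),
    hy _ (by simp) (by simp), hzu, weightedMatchingSum_eq_erase G y hu,
    weightedMatchingSum_eq_erase G y (Finset.mem_erase.2 ⟨huv, hu⟩), hfil',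
    Finset.erase_right_comm (a := u) (b := v)]
  ring

end SimpleGraph

/-! ### The functional `L` and its Jacobi-type recursion -/

/-- The coefficient of degree `n - 1` of the remainder modulo `p`. -/
noncomputable def Polynomial.modByMonicCoeff {R : Type*} [CommRing R] (p : R[X]) (n : ℕ) :
    R[X] →ₗ[R] R :=
  (lcoeff R (n - 1)).comp (modByMonicHom p)

namespace Polynomial

section

variable {R : Type*} [CommRing R] {p f : R[X]} {n : ℕ}

theorem modByMonicCoeff_of_dvd (hp : p.Monic) (h : p ∣ f) : modByMonicCoeff p n f = 0 := by
  simp [modByMonicCoeff, modByMonicHom, (modByMonic_eq_zero_iff_dvd hp).2 h]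

theorem modByMonicCoeff_of_natDegree_lt [Nontrivial R] (hp : p.Monic)
    (h : f.natDegree < p.natDegree) :
    modByMonicCoeff p n f = f.coeff (n - 1) := by
  have : f %ₘ p = f := (modByMonic_eq_self_iff hp).2 (degree_lt_degree h)
  simp [modByMonicCoeff, modByMonicHom, this]

theorem modByMonicCoeff_X_pow_mul_eq_one [Nontrivial R] (hp : p.Monic) (hn : p.natDegree = n)
    (hf : f.Monic) (k : ℕ) (h : k + f.natDegree + 1 = n) :
    modByMonicCoeff p n (X ^ k * f) = 1 := by
  have hd : (X ^ k * f).natDegree = k + f.natDegree := by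
    rw [(monic_X_pow k).natDegree_mul hf, natDegree_X_pow]
  rw [modByMonicCoeff_of_natDegree_lt hp (by omega), show n - 1 = (X ^ k * f).natDegree by omega]
  exact (monic_X_pow k).mul hf

theorem modByMonicCoeff_X_pow_mul_eq_zero [Nontrivial R] (hp : p.Monic) (hn : p.natDegree = n)
    (hf : f.Monic) (k : ℕ) (h : k + f.natDegree + 1 < n) :
    modByMonicCoeff p n (X ^ k * f) = 0 := by
  have hd : (X ^ k * f).natDegree = k + f.natDegree := by
    rw [(monic_X_pow k).natDegree_mul hf, natDegree_X_pow]
  rw [modByMonicCoeff_of_natDegree_lt hp (by omega)]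
  exact coeff_eq_zero_of_natDegree_lt (by omega)

end

/-- Two steps of a Jacobi-type recursion turn a product of two monic quadratics into a sum of
products of their coefficients. -/
theorem map_quadratic_mul_quadratic_mul {R ι κ : Type*} [CommRing R] (L : R[X] →ₗ[R] R)
    {p A : R[X]} {N : Finset ι} {N' : ι → Finset κ} {B : ι → R[X]} {D : ι → κ → R[X]}
    {a : R} {b : ι → R} (β γ β' γ' : R)
    (h0 : p = (X - C a) * A - ∑ w ∈ N, B w)
    (h1 : ∀ w ∈ N, A = (X - C (b w)) * B w - ∑ z ∈ N' w, D w z)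
    (hp : ∀ f, L (p * f) = 0) (hA : L A = 1) (hB : ∀ w ∈ N, L (B w) = 0)
    (hXB : ∀ w ∈ N, L (X * B w) = 1)
    (hD : ∀ w ∈ N, ∀ z ∈ N' w, L (D w z) = 0) (hXD : ∀ w ∈ N, ∀ z ∈ N' w, L (X * D w z) = 0)
    (hXXD : ∀ w ∈ N, ∀ z ∈ N' w, L (X ^ 2 * D w z) = 1) :
    L ((X ^ 2 + C β' * X + C γ') * ((X ^ 2 + C β * X + C γ) * A)) =
      ∑ w ∈ N, ((N' w).card : R) + ∑ w ∈ N, (a + b w + β) * (a + b w + β') +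
        (a ^ 2 + N.card + β * a + γ) * (a ^ 2 + N.card + β' * a + γ') := by
  have hC : ∀ (c : R) (f : R[X]), L (C c * f) = c * L f := fun c f => by
    rw [← smul_eq_C_mul, map_smul, smul_eq_mul]
  have hq : ∀ f, L ((X ^ 2 + C β' * X + C γ') * f) = L (X ^ 2 * f) + β' * L (X * f) + γ' * L f := by
    intro f
    rw [add_mul, add_mul, map_add, map_add, mul_assoc, hC, hC]
  -- The factor `* 1` lets `hp` apply.
  have eXA : X * A = p * 1 + C a * A + ∑ w ∈ N, B w := by
    rw [h0]; ring
  have eXB : ∀ w ∈ N, X * B w = A + C (b w) * B w + ∑ z ∈ N' w, D w z := by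
    intro w hw
    have := h1 w hw
    linear_combination -this
  have eXXA : X ^ 2 * A = p * (X + C a) + C (a ^ 2 + N.card) * A +
      ∑ w ∈ N, C (a + b w) * B w + ∑ w ∈ N, ∑ z ∈ N' w, D w z := by
    have : ∑ w ∈ N, X * B w = C (N.card : R) * A + ∑ w ∈ N, C (b w) * B w +
        ∑ w ∈ N, ∑ z ∈ N' w, D w z := by
      rw [Finset.sum_congr rfl eXB]
      simp [Finset.sum_add_distrib]
    simp only [C_add, C_pow, add_mul, Finset.sum_add_distrib, ← Finset.mul_sum] at this ⊢
    linear_combination (X + C a) * eXA + this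
  have lXA : L (X * A) = a := by
    rw [eXA, map_add, map_add, hp, hC, hA, map_sum, Finset.sum_eq_zero hB]
    ring
  have lXXA : L (X ^ 2 * A) = a ^ 2 + N.card := by
    rw [eXXA, map_add, map_add, map_add, hp, hC, hA, map_sum, map_sum]
    rw [Finset.sum_eq_zero fun w hw => by rw [hC, hB w hw, mul_zero],
      Finset.sum_eq_zero fun w hw => by rw [map_sum, Finset.sum_eq_zero (hD w hw)]]
    ring
  have lXXB : ∀ w ∈ N, L (X ^ 2 * B w) = a + b w := by
    intro w hw
    have : X ^ 2 * B w = X * A + C (b w) * (X * B w) + ∑ z ∈ N' w, X * D w z := by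
      rw [← Finset.mul_sum]
      linear_combination X * eXB w hw
    rw [this, map_add, map_add, hC, hXB w hw, lXA, map_sum, Finset.sum_eq_zero (hXD w hw)]
    ring
  -- The coefficients of `A`, `B w` and `D w z` are the entries of column `u` of `q(T)` at distance
  -- 0, 1 and 2.
  have eqA : (X ^ 2 + C β * X + C γ) * A = p * (X + C a + C β) +
      C (a ^ 2 + N.card + β * a + γ) * A + ∑ w ∈ N, C (a + b w + β) * B w +
        ∑ w ∈ N, ∑ z ∈ N' w, D w z := by
    simp only [C_add, C_mul, add_mul, Finset.sum_add_distrib, ← Finset.mul_sum] at eXXA ⊢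
    linear_combination eXXA + C β * eXA
  have lqp : ∀ f, L ((X ^ 2 + C β' * X + C γ') * (p * f)) = 0 := fun f => by
    rw [mul_left_comm, hp]
  rw [eqA, mul_add, mul_add, mul_add, map_add, map_add, map_add, lqp, mul_left_comm, hC, hq A,
    lXXA, lXA, hA, Finset.mul_sum, map_sum, Finset.mul_sum, map_sum]
  have s1 : ∑ w ∈ N, L ((X ^ 2 + C β' * X + C γ') * (C (a + b w + β) * B w)) =
      ∑ w ∈ N, (a + b w + β) * (a + b w + β') := by
    refine Finset.sum_congr rfl fun w hw => ?_
    rw [mul_left_comm, hC, hq, lXXB w hw, hXB w hw, hB w hw]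
    ring
  have s2 : ∑ w ∈ N, L ((X ^ 2 + C β' * X + C γ') * ∑ z ∈ N' w, D w z) =
      ∑ w ∈ N, ((N' w).card : R) := by
    refine Finset.sum_congr rfl fun w hw => ?_
    rw [Finset.mul_sum, map_sum, Finset.sum_congr rfl fun z hz => by
      rw [hq, hXXD w hw z hz, hXD w hw z hz, hD w hw z hz, mul_zero, mul_zero, add_zero, add_zero]]
    simp
  rw [s1, s2]
  ring

end Polynomial

/-! ### Positivity for vertex-deleted matching sums -/

namespace SimpleGraph

variable {V : Type*} [Fintype V]

open Classical in
theorem modByMonicCoeff_quadratic_mul_weightedMatchingSum_erase (G : SimpleGraph V) (d : V → ℂ)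
    (β γ β' γ' : ℂ) (u : V) :
    modByMonicCoeff (G.weightedMatchingSum (fun v => X - C (d v)) Finset.univ) (Fintype.card V)
      ((X ^ 2 + C β' * X + C γ') * ((X ^ 2 + C β * X + C γ) *
        G.weightedMatchingSum (fun v => X - C (d v)) (Finset.univ.erase u))) =
      ∑ w with G.Adj u w, (((Finset.univ.erase u).filter (fun z => G.Adj w z)).card : ℂ) +
      ∑ w with G.Adj u w, (d u + d w + β) * (d u + d w + β') +
      (d u ^ 2 + (Finset.univ.filter (fun w => G.Adj u w)).card + β * d u + γ) *
        (d u ^ 2 + (Finset.univ.filter (fun w => G.Adj u w)).card + β' * d u + γ') := by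
  set y : V → ℂ[X] := fun v => X - C (d v)
  have hmon : ∀ U, (G.weightedMatchingSum y U).Monic := fun U => (weightedMatchingSum_monic G d U).1
  have hdeg : ∀ U, (G.weightedMatchingSum y U).natDegree = U.card :=
    fun U => (weightedMatchingSum_monic G d U).2
  have hn : (G.weightedMatchingSum y Finset.univ).natDegree = Fintype.card V := hdeg _
  have cu : (Finset.univ.erase u).card + 1 = Fintype.card V :=
    Finset.card_erase_add_one (Finset.mem_univ u)
  have mw : ∀ w, G.Adj u w → w ∈ Finset.univ.erase u := fun w hw => by simp [hw.ne']
  have cw : ∀ w, G.Adj u w → ((Finset.univ.erase u).erase w).card + 2 = Fintype.card V := by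
    intro w hw
    have := Finset.card_erase_add_one (mw w hw)
    omega
  have cz : ∀ w, G.Adj u w → ∀ z ∈ (Finset.univ.erase u).filter (fun z => G.Adj w z),
      (((Finset.univ.erase u).erase w).erase z).card + 3 = Fintype.card V := by
    intro w hw z hz
    rw [Finset.mem_filter] at hz
    have := Finset.card_erase_add_one (Finset.mem_erase.2 ⟨hz.2.ne', hz.1⟩)
    have := cw w hw
    omega
  -- `L` is `1` on monic polynomials of degree `n - 1` and `0` on those of smaller degree.
  have one := fun k U (h : k + U.card + 1 = Fintype.card V) =>
    modByMonicCoeff_X_pow_mul_eq_one (hmon _) hn (hmon U) k (by rw [hdeg]; exact h)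
  have zero := fun k U (h : k + U.card + 1 < Fintype.card V) =>
    modByMonicCoeff_X_pow_mul_eq_zero (hmon _) hn (hmon U) k (by rw [hdeg]; exact h)
  refine map_quadratic_mul_quadratic_mul _ β γ β' γ'
    (B := fun w => G.weightedMatchingSum y ((Finset.univ.erase u).erase w))
    (D := fun w z => G.weightedMatchingSum y (((Finset.univ.erase u).erase w).erase z))
    (weightedMatchingSum_eq_erase G y (Finset.mem_univ u)) ?_ ?_ ?_ ?_ ?_ ?_ ?_ ?_
  · exact fun w hw => weightedMatchingSum_eq_erase G y (mw w (Finset.mem_filter.1 hw).2)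
  · exact fun f => modByMonicCoeff_of_dvd (hmon _) (dvd_mul_right _ _)
  · simpa using one 0 _ (by omega)
  · intro w hw
    have := cw w (Finset.mem_filter.1 hw).2
    simpa using zero 0 _ (by omega)
  · intro w hw
    have := cw w (Finset.mem_filter.1 hw).2
    simpa using one 1 _ (by omega)
  · intro w hw z hz
    have := cz w (Finset.mem_filter.1 hw).2 z hz
    simpa using zero 0 _ (by omega)
  · intro w hw z hz
    have := cz w (Finset.mem_filter.1 hw).2 z hz
    simpa using zero 1 _ (by omega)
  · intro w hw z hz
    have := cz w (Finset.mem_filter.1 hw).2 z hz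
    exact one 2 _ (by omega)

-- As `d` is real, conjugate coefficients turn the terms at distance 0 and 1 into squared moduli;
-- only the count of 2-paths remains.
open Classical ComplexConjugate in
theorem le_re_modByMonicCoeff_quadratic_mul (G : SimpleGraph V) (d : V → ℝ) (β γ : ℂ) (u : V) :
    ∑ w with G.Adj u w, (((Finset.univ.erase u).filter (fun z => G.Adj w z)).card : ℝ) ≤
    (modByMonicCoeff (G.weightedMatchingSum (fun v => X - C (d v : ℂ)) Finset.univ) (Fintype.card V)
      ((X ^ 2 + C (conj β) * X + C (conj γ)) * ((X ^ 2 + C β * X + C γ) *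
        G.weightedMatchingSum (fun v => X - C (d v : ℂ)) (Finset.univ.erase u)))).re := by
  have hc : ∀ x : ℂ, 0 ≤ (x * conj x).re := fun x => by
    rw [Complex.mul_conj]
    exact Complex.normSq_nonneg x
  have h1 : 0 ≤ (∑ w with G.Adj u w, ((d u : ℂ) + d w + β) * (d u + d w + conj β)).re := by
    rw [Complex.re_sum]
    refine Finset.sum_nonneg fun w _ => ?_
    simpa only [map_add, Complex.conj_ofReal] using hc (d u + d w + β)
  have h2 := hc ((d u : ℂ) ^ 2 + (Finset.univ.filter (fun w => G.Adj u w)).card + β * d u + γ)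
  simp only [map_add, map_mul, map_pow, Complex.conj_ofReal, map_natCast] at h2
  rw [modByMonicCoeff_quadratic_mul_weightedMatchingSum_erase, Complex.add_re, Complex.add_re]
  have h3 : (∑ w with G.Adj u w,
      (((Finset.univ.erase u).filter (fun z => G.Adj w z)).card : ℂ)).re =
      ∑ w with G.Adj u w, (((Finset.univ.erase u).filter (fun z => G.Adj w z)).card : ℝ) := by
    simp [Complex.re_sum]
  linarith

open Classical ComplexConjugate in
/-- No monic quadratic annihilates the sum of two vertex-deleted sums modulo the full sum, once
one of the two vertices starts a path of length two. -/
theorem not_dvd_quadratic_mul_weightedMatchingSum (G : SimpleGraph V) (d : V → ℝ) (β γ : ℂ)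
    {u w z : V} (v : V) (huw : G.Adj u w) (hwz : G.Adj w z) (hzu : z ≠ u) :
    ¬ G.weightedMatchingSum (fun v => X - C (d v : ℂ)) Finset.univ ∣
      (X ^ 2 + C β * X + C γ) *
        (G.weightedMatchingSum (fun v => X - C (d v : ℂ)) (Finset.univ.erase u) +
          G.weightedMatchingSum (fun v => X - C (d v : ℂ)) (Finset.univ.erase v)) := by
  intro h
  have h0 := modByMonicCoeff_of_dvd (n := Fintype.card V)
    (weightedMatchingSum_monic G (fun v => (d v : ℂ)) Finset.univ).1
    (h.mul_left (X ^ 2 + C (conj β) * X + C (conj γ)))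
  rw [mul_add, mul_add, map_add] at h0
  have h0' := congrArg Complex.re h0
  rw [Complex.add_re, Complex.zero_re] at h0'
  have hu := le_re_modByMonicCoeff_quadratic_mul G d β γ u
  have hv := le_re_modByMonicCoeff_quadratic_mul G d β γ v
  have pv : 0 ≤ ∑ w with G.Adj v w,
      (((Finset.univ.erase v).filter (fun z => G.Adj w z)).card : ℝ) :=
    Finset.sum_nonneg fun _ _ => Nat.cast_nonneg _
  have pu : 0 < ∑ w with G.Adj u w,
      (((Finset.univ.erase u).filter (fun z => G.Adj w z)).card : ℝ) := by
    refine Finset.sum_pos' (fun _ _ => Nat.cast_nonneg _) ⟨w, by simp [huw], ?_⟩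
    exact_mod_cast Finset.card_pos.2 ⟨z, by simp [hwz, hzu]⟩
  linarith

theorem Connected.exists_adj_adj_ne {V : Type*} {G : SimpleGraph V} (hG : G.Connected) {u v : V}
    (huv : u ≠ v) (hadj : ¬ G.Adj u v) : ∃ w z, G.Adj u w ∧ G.Adj w z ∧ z ≠ u := by
  obtain ⟨p, hp⟩ := hG.exists_isPath u v
  match p, hp with
  | .nil, _ => exact absurd rfl huv
  | .cons h .nil, _ => exact absurd h hadj
  | .cons h (.cons h' p), hp =>
    refine ⟨_, _, h, h', ?_⟩
    rintro rfl
    simp [Walk.cons_isPath_iff] at hp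

/-! ### Passing to roots and conclusion -/

open Classical in
theorem map_laplacianMatchingPoly_sup_edge (G : SimpleGraph V) {u v : V} (huv : u ≠ v)
    (hadj : ¬ G.Adj u v) :
    (G ⊔ edge u v).laplacianMatchingPoly.map (algebraMap ℤ ℂ) =
      G.laplacianMatchingPoly.map (algebraMap ℤ ℂ) -
        (G.weightedMatchingSum (fun v => X - C (G.degree v : ℂ)) (Finset.univ.erase u) +
          G.weightedMatchingSum (fun v => X - C (G.degree v : ℂ)) (Finset.univ.erase v)) := by
  obtain ⟨H, hH⟩ : ∃ H, H = G ⊔ edge u v := ⟨_, rfl⟩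
  have hu : H.degree u = G.degree u + 1 := by
    have : H.neighborFinset u = insert v (G.neighborFinset u) := by
      ext w
      simp only [mem_neighborFinset, hH, Finset.mem_insert, sup_adj, edge_adj]
      constructor
      · tauto
      · rintro (rfl | h) <;> tauto
    rw [← card_neighborFinset_eq_degree, this, Finset.card_insert_of_notMem (by simpa using hadj),
      card_neighborFinset_eq_degree]
  have hv : H.degree v = G.degree v + 1 := by
    have : H.neighborFinset v = insert u (G.neighborFinset v) := by
      ext w
      simp only [mem_neighborFinset, hH, Finset.mem_insert, sup_adj, edge_adj]
      constructor
      · tauto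
      · rintro (rfl | h) <;> tauto
    rw [← card_neighborFinset_eq_degree, this,
      Finset.card_insert_of_notMem (by simpa using fun h => hadj h.symm),
      card_neighborFinset_eq_degree]
  have hw : ∀ w, w ≠ u → w ≠ v → H.degree w = G.degree w := by
    intro w h1 h2
    rw [← card_neighborFinset_eq_degree, ← card_neighborFinset_eq_degree]
    congr 1
    ext x
    simp only [mem_neighborFinset, hH, sup_adj, edge_adj]
    tauto
  have key := weightedMatchingSum_sup_edge G (y := fun v => X - C (G.degree v : ℂ))
    (z := fun v => X - C (H.degree v : ℂ)) (Finset.mem_univ u) (Finset.mem_univ v) huv hadj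
    ?_ ?_ ?_
  · rw [← hH] at key
    rw [← hH, laplacianMatchingPoly_eq_weightedMatchingSum H ℂ,
      laplacianMatchingPoly_eq_weightedMatchingSum G ℂ, ← sub_sub, key]
  · simp only [hu]
    push_cast [C_add, C_1]
    ring
  · simp only [hv]
    push_cast [C_add, C_1]
    ring
  · intro w h1 h2
    simp only [hw w h1 h2]

theorem monic_map_laplacianMatchingPoly (G : SimpleGraph V) :
    (G.laplacianMatchingPoly.map (algebraMap ℤ ℂ)).Monic := by
  classical
  rw [laplacianMatchingPoly_eq_weightedMatchingSum G ℂ]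
  exact (weightedMatchingSum_monic G _ _).1

theorem map_laplacianMatchingPoly_eq_prod (G : SimpleGraph V) {r : Fin (Fintype.card V) → ℂ}
    (hr : Finset.univ.val.map r = G.laplacianMatchingRoots) :
    G.laplacianMatchingPoly.map (algebraMap ℤ ℂ) = ∏ k, (X - C (r k)) := by
  have h := (IsAlgClosed.splits (G.laplacianMatchingPoly.map (algebraMap ℤ ℂ))).eq_prod_roots_of_monic
    G.monic_map_laplacianMatchingPoly
  rw [h, ← aroots_def, ← laplacianMatchingRoots, ← hr, Multiset.map_map]
  rfl

end SimpleGraph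

/-- If two products of linear factors agree outside two indices, then a monic quadratic multiplies
their difference into a multiple of the first one. -/
theorem Polynomial.prod_X_sub_C_dvd_quadratic_mul_sub {ι R : Type*} [Fintype ι] [CommRing R]
    {r s : ι → R} {i j : ι} (hij : i ≠ j) (h : ∀ k, k ≠ i → k ≠ j → s k = r k) :
    ∃ β γ : R, (∏ k, (X - C (r k))) ∣
      (X ^ 2 + C β * X + C γ) * (∏ k, (X - C (r k)) - ∏ k, (X - C (s k))) := by
  classical
  have hj : j ∈ Finset.univ.erase i := by simp [hij.symm]
  have split : ∀ t : ι → R, ∏ k, (X - C (t k)) =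
      (X - C (t i)) * ((X - C (t j)) * ∏ k ∈ (Finset.univ.erase i).erase j, (X - C (t k))) :=
    fun t => by
      rw [Finset.mul_prod_erase _ (fun k => X - C (t k)) hj,
        Finset.mul_prod_erase _ (fun k => X - C (t k)) (Finset.mem_univ i)]
  have hT : ∏ k ∈ (Finset.univ.erase i).erase j, (X - C (s k)) =
      ∏ k ∈ (Finset.univ.erase i).erase j, (X - C (r k)) := by
    refine Finset.prod_congr rfl fun k hk => ?_
    simp only [Finset.mem_erase] at hk
    rw [h k hk.2.1 hk.1]
  -- The quadratic is `(X - C (r i)) * (X - C (r j))`; the common factors supply the rest of the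
  -- first product.
  refine ⟨-(r i + r j), r i * r j,
    (X - C (r i)) * (X - C (r j)) - (X - C (s i)) * (X - C (s j)), ?_⟩
  rw [split r, split s, hT]
  simp only [C_neg, C_add, C_mul]
  ring

theorem theorem1 {V : Type*} [Fintype V] (G : SimpleGraph V) (hG : G.Connected)
    (u v : V) (huv : u ≠ v) (hadj : ¬ G.Adj u v) :
    ¬ G.TwoPlaceLMRIV (G ⊔ SimpleGraph.edge u v) := by
  classical
  rintro ⟨r, s, hr, hs, i, j, hij, -, -, hk⟩
  obtain ⟨w, z, huw, hwz, hzu⟩ := hG.exists_adj_adj_ne huv hadj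
  obtain ⟨β, γ, hdvd⟩ := prod_X_sub_C_dvd_quadratic_mul_sub hij hk
  rw [← G.map_laplacianMatchingPoly_eq_prod hr,
    ← (G ⊔ SimpleGraph.edge u v).map_laplacianMatchingPoly_eq_prod hs,
    G.map_laplacianMatchingPoly_sup_edge huv hadj, sub_sub_cancel,
    SimpleGraph.laplacianMatchingPoly_eq_weightedMatchingSum G ℂ] at hdvd
  refine G.not_dvd_quadratic_mul_weightedMatchingSum (fun v => (G.degree v : ℝ)) β γ v huw hwz hzu ?_
  simpa only [Complex.ofReal_natCast] using hdvd
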